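/- Let $\Gamma$ be a finite connected simple graph with vertex set $X$, path-length distance $\partial$ and diameter $D\ge 3$, and assume that $\Gamma$ is distance-regular: for $0\le h,i,j\le D$ and $y,z\in X$ with $\partial(y,z)=h$, the number of $w\in X$ with $\partial(y,w)=i$ and $\partial(z,w)=j$ depends only on $h,i,j$. Let $k_i$ be the number of vertices at distance $i$ from a given vertex, let $A_i$ be the distance matrices ($(A_i)_{y,z}=1$ if $\partial(y,z)=i$ and $0$ otherwise), and put $A=A_1$. Let $I$ be the identity matrix, $J$ the all-ones matrix, and $M=\mathrm{Span}_{\mathbb C}(A_0,\dots,A_D)$ the Bose–Mesner algebra. Let $E_0,\dots,E_D$ be an ordering of the primitive idempotents of $\Gamma$, that is, a basis of $M$ consisting of real symmetric matrices with $E_0=|X|^{-1}J$, $\sum_i E_i=I$ and $E_iE_j=\delta_{i,j}E_i$. Let $P,Q$ be the eigenmatrices, given by $$A_j=\sum_{i=0}^D P_{i,j}E_i,\qquad E_j=|X|^{-1}\sum_{i=0}^D Q_{i,j}A_i\qquad(0\le j\le D),$$ and put $\theta_i=P_{i,1}$, $\theta^*_i=Q_{i,1}$. Assume that the ordering is formally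 self-dual, that is $P=Q$, and of $q$-Racah type, so that there are $q,a,\alpha,\varepsilon\in\mathbb C$ with $q,a,\alpha$ nonzero, $q^2\ne 1$, $q^2\neq -1$ and $$\theta_i=\theta^*_i=\alpha\,(a q^{2i-D}+a^{-1}q^{D-2i})+\varepsilon\qquad(0\le i\le D).$$ For $x\in X$ let $E^*_i(x)$ be the diagonal matrix with $(y,y)$-entry $1$ if $\partial(x,y)=i$ and $0$ otherwise, and let $A^*(x)$ be the diagonal matrix with $(y,y)$-entry $|X|(E_1)_{x,y}$. Assume that for every $x\in X$ $$\sum_{i=0}^D E^*_i(x)\,\frac{A-\varepsilon I}{\alpha}\,E^*_i(x)\Bigl(1+\frac{\theta_i-\varepsilon}{\alpha}\,\frac1{q+q^{-1}}\Bigr)=\sum_{i=0}^D E_i\,\frac{A^*(x)-\varepsilon I}{\alpha}\,E_i\Bigl(1+\frac{\theta_i-\varepsilon}{\alpha}\,\frac1{q+q^{-1}}\Bigr).$$ Let $\tau_i=(-1)^i a^{-i}q^{i(D-i)}$ for $0\le i\le D$, let $0\ne f\in\mathbb C$, and let $W=f\sum_{i=0}^D\tau_iE_i$. Then the following are equivalent: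 (i) $W$ is a spin model, that is: $W$ is symmetric; $W$ is type II, meaning that all entries of $W$ are nonzero and $WW^{(-)}\in\mathrm{Span}(I)$, where $W^{(-)}_{b,c}=1/W_{c,b}$; and for all $b,c,d\in X$ $$\sum_{e\in X}\frac{W_{e,c}W_{e,d}}{W_{e,b}}=|X|^{1/2}\,\frac{W_{c,d}}{W_{b,c}W_{d,b}};$$ (ii) $f^2=|X|^{1/2}\sum_{i=0}^D\tau_i^{-1}k_i$. Here $|X|^{1/2}>0$. -/

import Mathlib

namespace SpinDRG

/-! ### Type II matrices and spin models -/

section Matrices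

variable {X : Type*} [Fintype X] [DecidableEq X]

/-- The matrix `W^(-)`, with `(a, b)`-entry `1 / W b a` (used when all entries of `W` are nonzero). -/
noncomputable def invTranspose (W : Matrix X X ℂ) : Matrix X X ℂ :=
  Matrix.of fun a b => 1 / W b a

/-- `W` is type II: all entries are nonzero and `W * W^(-)` is a scalar multiple of `I`. -/
def IsTypeII (W : Matrix X X ℂ) : Prop :=
  (∀ a b, W a b ≠ 0) ∧ W * invTranspose W ∈ Submodule.span ℂ {(1 : Matrix X X ℂ)}

/-- Spin models: symmetric type II matrices satisfying the star-triangle (type III) condition. -/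
structure IsSpinModel (W : Matrix X X ℂ) : Prop where
  symm : W.IsSymm
  typeII : IsTypeII W
  starTriangle : ∀ a b c : X,
    ∑ e, W e b * W e c / W e a =
      ((Real.sqrt (Fintype.card X : ℝ) : ℝ) : ℂ) * (W b c / (W a b * W c a))

end Matrices

/-! ### Distance-regular graphs -/

section Graphs

variable {X : Type*} [Fintype X] [DecidableEq X]

/-- A finite connected simple graph is distance-regular if the number of vertices at distance `i`
from `y` and at distance `j` from `z` depends only on `i`, `j` and the distance of `y` and `z`. -/
structure IsDistanceRegular (G : SimpleGraph X) : Prop where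
  connected : G.Connected
  regular : ∀ (i j : ℕ) (y z y' z' : X), G.dist y z = G.dist y' z' →
    (Finset.univ.filter fun w => G.dist y w = i ∧ G.dist z w = j).card =
      (Finset.univ.filter fun w => G.dist y' w = i ∧ G.dist z' w = j).card

/-- The distance matrix `A_i`; `A_1` is the adjacency matrix. -/
noncomputable def distMatrix (G : SimpleGraph X) (i : ℕ) : Matrix X X ℂ :=
  Matrix.of fun y z => if G.dist y z = i then 1 else 0

/-- The Bose-Mesner algebra (as a space of matrices) of a graph of diameter `D`: the span of the
distance matrices `A_0, …, A_D`. -/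
def boseMesner (G : SimpleGraph X) (D : ℕ) : Submodule ℂ (Matrix X X ℂ) :=
  Submodule.span ℂ (Set.range fun i : Fin (D + 1) => distMatrix G i)

/-- `E_0, …, E_D` is an ordering of the primitive idempotents of the graph `G` of diameter `D`:
a basis of the Bose-Mesner algebra consisting of real symmetric, mutually orthogonal idempotents
with sum `I`, and with `E_0 = |X|⁻¹ J`. -/
structure IsPrimitiveIdempotentOrdering (G : SimpleGraph X) (D : ℕ)
    (E : Fin (D + 1) → Matrix X X ℂ) : Prop where
  linearIndependent : LinearIndependent ℂ E
  span_eq : Submodule.span ℂ (Set.range E) = boseMesner G D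
  zero_eq : E 0 = (Fintype.card X : ℂ)⁻¹ • Matrix.of fun _ _ => (1 : ℂ)
  sum_eq : ∑ i, E i = 1
  symm : ∀ i, (E i).transpose = E i
  real : ∀ i, (E i).map (starRingEnd ℂ) = E i
  mul_eq : ∀ i j, E i * E j = if i = j then E i else 0

/-- `P` is the first eigenmatrix: `A_j = ∑ i, P i j • E_i`. -/
def IsFirstEigenmatrix (G : SimpleGraph X) (D : ℕ) (E : Fin (D + 1) → Matrix X X ℂ)
    (P : Matrix (Fin (D + 1)) (Fin (D + 1)) ℂ) : Prop :=
  ∀ j : Fin (D + 1), distMatrix G j = ∑ i, P i j • E i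

/-- `Q` is the second eigenmatrix: `E_j = |X|⁻¹ ∑ i, Q i j • A_i`. -/
def IsSecondEigenmatrix (G : SimpleGraph X) (D : ℕ) (E : Fin (D + 1) → Matrix X X ℂ)
    (Q : Matrix (Fin (D + 1)) (Fin (D + 1)) ℂ) : Prop :=
  ∀ j : Fin (D + 1),
    E j = (Fintype.card X : ℂ)⁻¹ • ∑ i : Fin (D + 1), Q i j • distMatrix G i

/-- The dual primitive idempotent `E*_i = E*_i(x)` with respect to the base vertex `x`. -/
noncomputable def dualIdempotent (G : SimpleGraph X) (x : X) (i : ℕ) : Matrix X X ℂ :=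
  Matrix.diagonal fun y => if G.dist x y = i then 1 else 0

/-- The dual adjacency matrix `A* = A*_1(x)`, the diagonal matrix with `(y, y)`-entry
`|X| (E_1)_{x, y}`. -/
noncomputable def dualAdjacency {D : ℕ} (E : Fin (D + 1) → Matrix X X ℂ) (x : X) : Matrix X X ℂ :=
  Matrix.diagonal fun y => (Fintype.card X : ℂ) * E 1 x y

/-- For the base vertex `x` the two expressions that define `Z(x)` agree:
`∑ i, E*_i ((A - ε I) / α) E*_i (1 + (θ_i - ε) / α / (q + q⁻¹))`
`= ∑ i, E_i ((A* - ε I) / α) E_i (1 + (θ_i - ε) / α / (q + q⁻¹))`. -/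
def ZEquality (G : SimpleGraph X) {D : ℕ} (E : Fin (D + 1) → Matrix X X ℂ)
    (θ : Fin (D + 1) → ℂ) (q α ε : ℂ) (x : X) : Prop :=
  ∑ i : Fin (D + 1), (1 + (θ i - ε) / α * (1 / (q + q⁻¹))) •
      (dualIdempotent G x i * (α⁻¹ • (distMatrix G 1 - ε • (1 : Matrix X X ℂ))) *
        dualIdempotent G x i) =
    ∑ i : Fin (D + 1), (1 + (θ i - ε) / α * (1 / (q + q⁻¹))) •
      (E i * (α⁻¹ • (dualAdjacency E x - ε • (1 : Matrix X X ℂ))) * E i)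

end Graphs

/-- `τ_i = (-1)^i a^{-i} q^{i (D - i)}`. -/
noncomputable def tau (D : ℕ) (a q : ℂ) (i : ℕ) : ℂ :=
  (-1) ^ i * a ^ (-(i : ℤ)) * q ^ ((i : ℤ) * ((D : ℤ) - (i : ℤ)))

/-- The matrix `W = f ∑ i, τ_i E_i`. -/
noncomputable def matrixW {X : Type*} {D : ℕ} (E : Fin (D + 1) → Matrix X X ℂ) (a q f : ℂ) :
    Matrix X X ℂ :=
  f • ∑ i : Fin (D + 1), tau D a q i • E i

end SpinDRG

set_option linter.unusedSectionVars false

namespace SpinDRG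

section IdempotentSystems

lemma idem_ext {R : Type*} [Ring R] {n : ℕ} {F : Fin n → R} (hs : ∑ i, F i = 1) {x y : R} (h : ∀ i j, F i * x * F j = F i * y * F j) :
    x = y := by
  have key : ∀ z : R, z = ∑ i, ∑ j, F i * z * F j := fun z => by
    simp_rw [← Finset.mul_sum, ← Finset.sum_mul, hs, one_mul, mul_one]
  rw [key x, key y]
  exact Finset.sum_congr rfl fun i _ => Finset.sum_congr rfl fun j _ => h i j

variable {R : Type*} [Ring R] [Algebra ℂ R] {n : ℕ} {F : Fin n → R}

lemma idem_mul_sum (hF : ∀ i j, F i * F j = if i = j then F i else 0) (c : Fin n → ℂ) (i : Fin n) :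
    F i * ∑ j, c j • F j = c i • F i := by
  simp [Finset.mul_sum, hF]

lemma sum_mul_idem (hF : ∀ i j, F i * F j = if i = j then F i else 0) (c : Fin n → ℂ) (i : Fin n) :
    (∑ j, c j • F j) * F i = c i • F i := by
  simp [Finset.sum_mul, hF]

lemma sum_mul_sum_idem (hF : ∀ i j, F i * F j = if i = j then F i else 0) (c d : Fin n → ℂ) :
    (∑ j, c j • F j) * (∑ j, d j • F j) = ∑ j, (c j * d j) • F j := by
  rw [Finset.sum_mul]
  refine Finset.sum_congr rfl fun i _ => ?_
  rw [smul_mul_assoc, idem_mul_sum hF, smul_smul]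

lemma idem_mul_diag_mul (hF : ∀ i j, F i * F j = if i = j then F i else 0) (g : Fin n → ℂ) (B : R)
    (i j : Fin n) :
    F i * (∑ l, g l • (F l * B * F l)) * F j = if i = j then g i • (F i * B * F i) else 0 := by
  have h : ∀ l, F i * (g l • (F l * B * F l)) * F j =
      if i = l then (if i = j then g i • (F i * B * F i) else 0) else 0 := by
    intro l
    have : F i * (g l • (F l * B * F l)) * F j = g l • ((F i * F l) * B * (F l * F j)) := by
      simp only [mul_smul_comm, smul_mul_assoc, mul_assoc]
    rw [this, hF, hF]
    by_cases h1 : i = l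
    · subst h1; by_cases h2 : i = j <;> simp [h2]
    · simp [h1]
  rw [Finset.mul_sum, Finset.sum_mul, Finset.sum_congr rfl fun l _ => h l]
  simp

/-- Conjugation of an element that is tridiagonal with respect to a system of idempotents. -/
lemma conj_eq (hF : ∀ i j, F i * F j = if i = j then F i else 0) (hs : ∑ i, F i = 1) (B : R)
    (u v θ : Fin n → ℂ) (r s : ℂ) (h2 : ∀ i, u i * v i = 1)
    (h1 : ∀ i j, i ≠ j → F i * B * F j ≠ 0 → u i * v j = -(r * θ i - s * θ j)) :
    (∑ i, u i • F i) * B * (∑ i, v i • F i) =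
      (∑ i, (1 + (r - s) * θ i) • (F i * B * F i)) -
        (r • ((∑ i, θ i • F i) * B) - s • (B * ∑ i, θ i • F i)) := by
  refine idem_ext hs fun i j => ?_
  have e1 : F i * ((∑ i, u i • F i) * B * (∑ i, v i • F i)) * F j =
      (F i * ∑ i, u i • F i) * B * ((∑ i, v i • F i) * F j) := by simp only [mul_assoc]
  have e2 : F i * ((∑ i, θ i • F i) * B) * F j = θ i • (F i * B * F j) := by
    rw [← mul_assoc, idem_mul_sum hF, smul_mul_assoc, smul_mul_assoc]
  have e3 : F i * (B * ∑ i, θ i • F i) * F j = θ j • (F i * B * F j) := by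
    rw [← mul_assoc, mul_assoc _ _ (F j), sum_mul_idem hF, mul_smul_comm]
  have e4 : F i * ((∑ i, (1 + (r - s) * θ i) • (F i * B * F i)) -
        (r • ((∑ i, θ i • F i) * B) - s • (B * ∑ i, θ i • F i))) * F j =
      F i * (∑ i, (1 + (r - s) * θ i) • (F i * B * F i)) * F j -
        (r • (F i * ((∑ i, θ i • F i) * B) * F j) - s • (F i * (B * ∑ i, θ i • F i) * F j)) := by
    simp only [mul_sub, sub_mul, mul_smul_comm, smul_mul_assoc]
  rw [e1, e4, e2, e3, idem_mul_diag_mul hF, idem_mul_sum hF, sum_mul_idem hF]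
  simp only [smul_mul_assoc, mul_smul_comm, smul_smul]
  rw [mul_comm (v j)]
  by_cases hij : i = j
  · subst hij
    rw [if_pos rfl, h2, ← sub_smul, ← sub_smul]
    congr 1; ring
  · rw [if_neg hij, zero_sub, ← sub_smul, ← neg_smul]
    by_cases h0 : F i * B * F j = 0
    · simp [h0]
    · rw [h1 i j hij h0]

/-- An element that intertwines two elements with simple spectrum intertwines their idempotents. -/
lemma intertwine_idem {F' : Fin n → R} (hF : ∀ i j, F i * F j = if i = j then F i else 0)
    (hs : ∑ i, F i = 1) (hF' : ∀ i j, F' i * F' j = if i = j then F' i else 0)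
    (hs' : ∑ i, F' i = 1) (θ : Fin n → ℂ) (hθ : Function.Injective θ) (Ψ : R)
    (h : Ψ * (∑ i, θ i • F i) = (∑ i, θ i • F' i) * Ψ) (i : Fin n) : Ψ * F i = F' i * Ψ := by
  have key : ∀ i j, i ≠ j → F' i * Ψ * F j = 0 := by
    intro i j hij
    have e : F' i * (Ψ * (∑ i, θ i • F i)) * F j = F' i * ((∑ i, θ i • F' i) * Ψ) * F j := by rw [h]
    rw [← mul_assoc, mul_assoc _ _ (F j), sum_mul_idem hF, ← mul_assoc, idem_mul_sum hF',
      mul_smul_comm, smul_mul_assoc, smul_mul_assoc] at e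
    rw [← sub_eq_zero, ← sub_smul] at e
    exact (smul_eq_zero.1 e).resolve_left (sub_ne_zero.2 fun h' => hij (hθ h').symm)
  have e1 : Ψ * F i = F' i * Ψ * F i := by
    calc Ψ * F i = (∑ j, F' j) * Ψ * F i := by rw [hs', one_mul]
      _ = _ := by
        rw [Finset.sum_mul, Finset.sum_mul]
        exact Finset.sum_eq_single i (fun j _ hj => key j i hj) (by simp)
  have e2 : F' i * Ψ = F' i * Ψ * F i := by
    calc F' i * Ψ = F' i * Ψ * ∑ j, F j := by rw [hs, mul_one]
      _ = _ := by
        rw [Finset.mul_sum]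
        exact Finset.sum_eq_single i (fun j _ hj => key i j hj.symm) (by simp)
  rw [e1, ← e2]

end IdempotentSystems

lemma tau_ne_zero {a q : ℂ} (ha : a ≠ 0) (hq : q ≠ 0) (D i : ℕ) : tau D a q i ≠ 0 := by
  unfold tau
  have := zpow_ne_zero (-(i : ℤ)) ha
  have := zpow_ne_zero ((i : ℤ) * ((D : ℤ) - (i : ℤ))) hq
  simp_all

lemma tau_succ {a q : ℂ} (ha : a ≠ 0) (hq : q ≠ 0) (D i : ℕ) :
    tau D a q (i + 1) = -(a⁻¹ * (q ^ (2 * (i : ℤ) + 1 - D))⁻¹) * tau D a q i := by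
  unfold tau
  have e1 : a ^ (-((i + 1 : ℕ) : ℤ)) = a ^ (-(i : ℤ)) * a⁻¹ := by
    rw [← zpow_neg_one, ← zpow_add₀ ha]; congr 1; push_cast; ring
  have e2 : q ^ (((i + 1 : ℕ) : ℤ) * ((D : ℤ) - ((i + 1 : ℕ) : ℤ))) =
      q ^ ((i : ℤ) * ((D : ℤ) - (i : ℤ))) * (q ^ (2 * (i : ℤ) + 1 - D))⁻¹ := by
    rw [← zpow_neg, ← zpow_add₀ hq]; congr 1; push_cast; ring
  rw [e1, e2]; ring

/-- The normalised eigenvalues of `q`-Racah type. -/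
noncomputable def racahEigenvalue (D : ℕ) (a q : ℂ) (i : ℕ) : ℂ :=
  a * q ^ (2 * (i : ℤ) - (D : ℤ)) + a⁻¹ * q ^ ((D : ℤ) - 2 * (i : ℤ))

lemma racahEigenvalue_eq {q : ℂ} (a : ℂ) (hq : q ≠ 0) (D i : ℕ) :
    racahEigenvalue D a q i =
      a * (q ^ (2 * (i : ℤ) + 1 - D) * q⁻¹) + a⁻¹ * ((q ^ (2 * (i : ℤ) + 1 - D))⁻¹ * q) := by
  unfold racahEigenvalue
  congr 2
  · rw [← zpow_neg_one, ← zpow_add₀ hq]; congr 1; ring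
  · rw [← zpow_neg, ← zpow_add_one₀ hq]; congr 1; ring

lemma racahEigenvalue_succ {q : ℂ} (a : ℂ) (hq : q ≠ 0) (D i : ℕ) :
    racahEigenvalue D a q (i + 1) =
      a * (q ^ (2 * (i : ℤ) + 1 - D) * q) + a⁻¹ * ((q ^ (2 * (i : ℤ) + 1 - D))⁻¹ * q⁻¹) := by
  unfold racahEigenvalue
  congr 2
  · rw [← zpow_add_one₀ hq]; congr 1; push_cast; ring
  · rw [← zpow_neg, ← zpow_neg_one, ← zpow_add₀ hq]; congr 1; push_cast; ring

lemma sq_sub_inv_sq_ne_zero {q : ℂ} (hq : q ≠ 0) (hq1 : q ^ 2 ≠ 1) (hq2 : q ^ 2 ≠ -1) :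
    q ^ 2 - (q ^ 2)⁻¹ ≠ 0 := by
  have h : q ^ 2 - (q ^ 2)⁻¹ = (q ^ 2 - 1) * (q ^ 2 - -1) * (q ^ 2)⁻¹ := by
    field_simp; ring
  rw [h]
  exact mul_ne_zero (mul_ne_zero (sub_ne_zero.2 hq1) (sub_ne_zero.2 hq2))
    (inv_ne_zero (pow_ne_zero 2 hq))

lemma racah_ratio {a q : ℂ} (ha : a ≠ 0) (hq : q ≠ 0) (hq3 : q ^ 2 - (q ^ 2)⁻¹ ≠ 0) (D : ℕ)
    {i j : ℕ} (h : i = j + 1 ∨ j = i + 1) :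
    (tau D a q i)⁻¹ * tau D a q j =
      -(q / (q ^ 2 - (q ^ 2)⁻¹) * racahEigenvalue D a q i -
        q⁻¹ / (q ^ 2 - (q ^ 2)⁻¹) * racahEigenvalue D a q j) := by
  have key : ∀ i, ((tau D a q (i+1))⁻¹ * tau D a q i =
      -(q / (q ^ 2 - (q ^ 2)⁻¹) * racahEigenvalue D a q (i+1) -
        q⁻¹ / (q ^ 2 - (q ^ 2)⁻¹) * racahEigenvalue D a q i)) ∧
      ((tau D a q i)⁻¹ * tau D a q (i+1) =
      -(q / (q ^ 2 - (q ^ 2)⁻¹) * racahEigenvalue D a q i -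
        q⁻¹ / (q ^ 2 - (q ^ 2)⁻¹) * racahEigenvalue D a q (i+1))) := by
    intro i
    have ht := tau_ne_zero ha hq D i
    have hx : q ^ (2 * (i : ℤ) + 1 - D) ≠ 0 := zpow_ne_zero _ hq
    rw [tau_succ ha hq, racahEigenvalue_succ a hq, racahEigenvalue_eq a hq]
    generalize q ^ (2 * (i : ℤ) + 1 - D) = x at *
    generalize tau D a q i = t at *
    generalize hd : q ^ 2 - (q ^ 2)⁻¹ = d at *
    constructor
    · have e : q / d * (a * (x * q) + a⁻¹ * (x⁻¹ * q⁻¹)) - q⁻¹ / d * (a * (x * q⁻¹) + a⁻¹ * (x⁻¹ * q))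
          = a * x * (q ^ 2 - (q ^ 2)⁻¹) / d := by field_simp; ring
      rw [e, hd, mul_div_cancel_right₀ _ hq3]
      field_simp
    · have e : q / d * (a * (x * q⁻¹) + a⁻¹ * (x⁻¹ * q)) - q⁻¹ / d * (a * (x * q) + a⁻¹ * (x⁻¹ * q⁻¹))
          = a⁻¹ * x⁻¹ * (q ^ 2 - (q ^ 2)⁻¹) / d := by field_simp; ring
      rw [e, hd, mul_div_cancel_right₀ _ hq3]
      field_simp
  rcases h with rfl | rfl
  · exact (key j).1
  · exact (key i).2

section Braid

variable {R : Type*} [Ring R] [Algebra ℂ R] {D : ℕ}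

lemma racah_conj {F : Fin (D + 1) → R} (hF : ∀ i j, F i * F j = if i = j then F i else 0)
    (hs : ∑ i, F i = 1) (B : R) {a q : ℂ} (ha : a ≠ 0) (hq : q ≠ 0)
    (hq1 : q ^ 2 ≠ 1) (hq2 : q ^ 2 ≠ -1)
    (htri : ∀ i j : Fin (D + 1), ((i : ℕ) + 1 < j ∨ (j : ℕ) + 1 < i) → F i * B * F j = 0) :
    (∑ i : Fin (D + 1), (tau D a q i)⁻¹ • F i) * B * (∑ i : Fin (D + 1), tau D a q i • F i) =
      (∑ i : Fin (D + 1), (1 + racahEigenvalue D a q i * (1 / (q + q⁻¹))) • (F i * B * F i)) -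
        ((q / (q ^ 2 - (q ^ 2)⁻¹)) • ((∑ i : Fin (D + 1), racahEigenvalue D a q i • F i) * B) -
          (q⁻¹ / (q ^ 2 - (q ^ 2)⁻¹)) • (B * ∑ i : Fin (D + 1), racahEigenvalue D a q i • F i)) ∧
    (∑ i : Fin (D + 1), tau D a q i • F i) * B * (∑ i : Fin (D + 1), (tau D a q i)⁻¹ • F i) =
      (∑ i : Fin (D + 1), (1 + racahEigenvalue D a q i * (1 / (q + q⁻¹))) • (F i * B * F i)) -
        ((q / (q ^ 2 - (q ^ 2)⁻¹)) • (B * ∑ i : Fin (D + 1), racahEigenvalue D a q i • F i) -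
          (q⁻¹ / (q ^ 2 - (q ^ 2)⁻¹)) • ((∑ i : Fin (D + 1), racahEigenvalue D a q i • F i) * B)) := by
  have hq3 := sq_sub_inv_sq_ne_zero hq hq1 hq2
  have hadj : ∀ i j : Fin (D + 1), i ≠ j → F i * B * F j ≠ 0 →
      (i : ℕ) = j + 1 ∨ (j : ℕ) = i + 1 := by
    intro i j hij h0
    have := mt (htri i j) h0
    have := fun h => hij (Fin.ext h)
    omega
  have hc : q / (q ^ 2 - (q ^ 2)⁻¹) - q⁻¹ / (q ^ 2 - (q ^ 2)⁻¹) = 1 / (q + q⁻¹) := by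
    have hp : q + q⁻¹ ≠ 0 := by
      intro h
      apply hq2
      field_simp at h
      linear_combination h
    have e : q ^ 2 - (q ^ 2)⁻¹ = (q - q⁻¹) * (q + q⁻¹) := by field_simp; ring
    have hm : q - q⁻¹ ≠ 0 := fun h => hq3 (by rw [e, h, zero_mul])
    rw [e, ← sub_div]
    field_simp
  constructor
  · rw [conj_eq hF hs B _ _ (fun i => racahEigenvalue D a q i) _ _
      (fun i => inv_mul_cancel₀ (tau_ne_zero ha hq D i))
      (fun i j hij h0 => racah_ratio ha hq hq3 D (hadj i j hij h0)), hc]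
    simp only [mul_comm]
  · rw [conj_eq hF hs B _ _ (fun i => racahEigenvalue D a q i)
      (-(q⁻¹ / (q ^ 2 - (q ^ 2)⁻¹))) (-(q / (q ^ 2 - (q ^ 2)⁻¹)))
      (fun i => mul_inv_cancel₀ (tau_ne_zero ha hq D i))
      (fun i j hij h0 => by
        rw [mul_comm, racah_ratio ha hq hq3 D (hadj i j hij h0).symm]; ring)]
    rw [← hc, neg_smul, neg_smul]
    congr 1
    · refine Finset.sum_congr rfl fun i _ => ?_
      congr 1; ring
    · abel

/-- The intertwining and braid relations for two systems of idempotents of `q`-Racah type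
whose associated diagonal parts agree. -/
lemma racah_braid {F F' : Fin (D + 1) → R}
    (hF : ∀ i j, F i * F j = if i = j then F i else 0) (hs : ∑ i, F i = 1)
    (hF' : ∀ i j, F' i * F' j = if i = j then F' i else 0) (hs' : ∑ i, F' i = 1)
    {a q : ℂ} (ha : a ≠ 0) (hq : q ≠ 0) (hq1 : q ^ 2 ≠ 1) (hq2 : q ^ 2 ≠ -1)
    (hinj : Function.Injective fun i : Fin (D + 1) => racahEigenvalue D a q i) {A A' : R}
    (hA : A = ∑ i : Fin (D + 1), racahEigenvalue D a q i • F i)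
    (hA' : A' = ∑ i : Fin (D + 1), racahEigenvalue D a q i • F' i)
    (htri : ∀ i j : Fin (D + 1), ((i : ℕ) + 1 < j ∨ (j : ℕ) + 1 < i) → F i * A' * F j = 0)
    (htri' : ∀ i j : Fin (D + 1), ((i : ℕ) + 1 < j ∨ (j : ℕ) + 1 < i) → F' i * A * F' j = 0)
    (hZ : ∑ i : Fin (D + 1), (1 + racahEigenvalue D a q i * (1 / (q + q⁻¹))) • (F' i * A * F' i) =
      ∑ i : Fin (D + 1), (1 + racahEigenvalue D a q i * (1 / (q + q⁻¹))) • (F i * A' * F i))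
    {W W' : R} (hW : W = ∑ i : Fin (D + 1), tau D a q i • F i)
    (hW' : W' = ∑ i : Fin (D + 1), tau D a q i • F' i) :
    (∀ i, W * W' * W * F' i = F i * (W * W' * W)) ∧ W * W' * W = W' * W * W' := by
  obtain ⟨V, hV⟩ : ∃ V, V = ∑ i : Fin (D + 1), (tau D a q i)⁻¹ • F i := ⟨_, rfl⟩
  obtain ⟨V', hV'⟩ : ∃ V', V' = ∑ i : Fin (D + 1), (tau D a q i)⁻¹ • F' i := ⟨_, rfl⟩
  have ht : ∀ i : Fin (D + 1), tau D a q i ≠ 0 := fun i => tau_ne_zero ha hq D i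
  have hWV : W * V = 1 := by
    rw [hW, hV, sum_mul_sum_idem hF, ← hs]; simp [ht]
  have hVW : V * W = 1 := by
    rw [hW, hV, sum_mul_sum_idem hF, ← hs]; simp [ht]
  have hWV' : W' * V' = 1 := by
    rw [hW', hV', sum_mul_sum_idem hF', ← hs']; simp [ht]
  have hVW' : V' * W' = 1 := by
    rw [hW', hV', sum_mul_sum_idem hF', ← hs']; simp [ht]
  obtain ⟨c1, c2⟩ := racah_conj hF hs A' ha hq hq1 hq2 htri
  obtain ⟨d1, d2⟩ := racah_conj hF' hs' A ha hq hq1 hq2 htri'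
  rw [← hA, ← hW, ← hV] at c1 c2
  rw [← hA', ← hW', ← hV', hZ] at d1 d2
  have r1 : W * A' * V = V' * A * W' := by rw [c2, d1]
  have r2 : V * A' * W = W' * A * V' := by rw [c1, d2]
  have s1 : W' * W * A' = A * W' * W := by
    calc W' * W * A' = W' * (W * A' * V) * W := by simp only [mul_assoc, hVW, mul_one]
      _ = (W' * V') * A * W' * W := by rw [r1]; simp only [mul_assoc]
      _ = _ := by rw [hWV', one_mul]
  have s2 : W * W' * A = A' * W * W' := by
    calc W * W' * A = W * (W' * A * V') * W' := by simp only [mul_assoc, hVW', mul_one]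
      _ = (W * V) * A' * W * W' := by rw [← r2]; simp only [mul_assoc]
      _ = _ := by rw [hWV, one_mul]
  have hAW : A * W = W * A := by
    rw [hA, hW, sum_mul_sum_idem hF, sum_mul_sum_idem hF]; simp only [mul_comm]
  have t1 : W * W' * W * A = A' * (W * W' * W) := by
    rw [mul_assoc _ W A, ← hAW, ← mul_assoc, s2]; simp only [mul_assoc]
  have t2 : W * W' * W * A' = A * (W * W' * W) := by
    rw [mul_assoc W W' W, mul_assoc W _ A', s1, ← mul_assoc A, hAW]; simp only [mul_assoc]
  rw [hA, hA'] at t1 t2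
  have u1 := intertwine_idem hF hs hF' hs' _ hinj _ t1
  refine ⟨intertwine_idem hF' hs' hF hs _ hinj _ t2, ?_⟩
  have hb : W * W' * W * W = W' * (W * W' * W) := by
    conv_lhs => rw [hW, Finset.mul_sum]
    conv_rhs => rw [hW', Finset.sum_mul]
    refine Finset.sum_congr rfl fun i _ => ?_
    rw [mul_smul_comm, smul_mul_assoc, ← hW, ← hW', u1]
  calc W * W' * W = W * W' * W * W * V := by rw [mul_assoc _ W V, hWV, mul_one]
    _ = _ := by rw [hb]; simp only [mul_assoc, hWV, mul_one]

end Braid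

section DistanceRegular

variable {X : Type*} [Fintype X] [DecidableEq X] {G : SimpleGraph X} {D : ℕ}

lemma exists_adj_dist_eq {V : Type*} {G : SimpleGraph V} (hG : G.Connected) {y z : V} {m : ℕ}
    (h : G.dist y z = m + 1) : ∃ w, G.dist y w = 1 ∧ G.dist w z = m := by
  obtain ⟨p, hp⟩ := hG.exists_walk_length_eq_dist y z
  cases p with
  | nil => simp at h
  | @cons _ w _ hadj p =>
    have h1 : G.dist y w = 1 := SimpleGraph.dist_eq_one_iff_adj.2 hadj
    have h2 := SimpleGraph.dist_le p
    have h3 := hG.dist_triangle (u := y) (v := w) (w := z)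
    rw [SimpleGraph.Walk.length_cons] at hp
    exact ⟨w, h1, by omega⟩

lemma dist_lt_succ_diam (hG : IsDistanceRegular G) (hdiam : G.diam = D) (y z : X) :
    G.dist y z < D + 1 := by
  have := hG.connected.nonempty
  have := SimpleGraph.dist_le_diam (SimpleGraph.connected_iff_ediam_ne_top.1 hG.connected)
    (u := y) (v := z)
  omega

lemma exists_dist_eq (hG : IsDistanceRegular G) (hdiam : G.diam = D) {i : ℕ} (hi : i ≤ D) :
    ∃ y z, G.dist y z = i := by
  induction hi using Nat.decreasingInduction with
  | self =>
    have := hG.connected.nonempty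
    rw [← hdiam]
    exact SimpleGraph.exists_dist_eq_diam
  | of_succ m _ ih =>
    obtain ⟨y, z, h⟩ := ih
    obtain ⟨w, -, hw⟩ := exists_adj_dist_eq hG.connected h
    exact ⟨w, z, hw⟩

/-- The intersection numbers of a distance-regular graph exist. -/
lemma exists_intersectionNumbers (hG : IsDistanceRegular G) : ∃ p : ℕ → ℕ → ℕ → ℕ,
    ∀ i j y z, (Finset.univ.filter fun w => G.dist y w = i ∧ G.dist z w = j).card =
      p (G.dist y z) i j := by
  classical
  refine ⟨fun h i j => if H : ∃ u : X × X, G.dist u.1 u.2 = h then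
    (Finset.univ.filter fun w => G.dist H.choose.1 w = i ∧ G.dist H.choose.2 w = j).card else 0,
    fun i j y z => ?_⟩
  have H : ∃ u : X × X, G.dist u.1 u.2 = G.dist y z := ⟨(y, z), rfl⟩
  simp only [dif_pos H]
  exact hG.regular i j _ _ _ _ H.choose_spec.symm

lemma sum_smul_distMatrix_apply (c : Fin (D + 1) → ℂ) (y z : X) (h : G.dist y z < D + 1) :
    (∑ i : Fin (D + 1), c i • distMatrix G i) y z = c ⟨G.dist y z, h⟩ := by
  rw [Matrix.sum_apply, Finset.sum_eq_single ⟨G.dist y z, h⟩]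
  · simp [distMatrix]
  · intro i _ hi
    have : G.dist y z ≠ i := fun h' => hi (Fin.ext h'.symm)
    simp [distMatrix, this]
  · simp

lemma sum_smul_dualIdempotent (c : Fin (D + 1) → ℂ) (x : X) (h : ∀ y, G.dist x y < D + 1) :
    (∑ i : Fin (D + 1), c i • dualIdempotent G x i) =
      Matrix.diagonal fun y => c ⟨G.dist x y, h y⟩ := by
  ext y z
  rw [Matrix.sum_apply, Finset.sum_eq_single ⟨G.dist x y, h y⟩]
  · by_cases hyz : y = z <;> simp [dualIdempotent, hyz]
  · intro i _ hi
    have : G.dist x y ≠ i := fun h' => hi (Fin.ext h'.symm)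
    by_cases hyz : y = z
    · subst hyz; simp [dualIdempotent, this]
    · simp [dualIdempotent, hyz]
  · simp

lemma dualIdempotent_mul (x : X) (i j : Fin (D + 1)) :
    dualIdempotent G x i * dualIdempotent G x j = if i = j then dualIdempotent G x i else 0 := by
  unfold dualIdempotent
  rw [Matrix.diagonal_mul_diagonal]
  by_cases h : i = j
  · subst h; simp
  · rw [if_neg h, ← Matrix.diagonal_zero]
    congr 1; ext y
    by_cases h1 : G.dist x y = i
    · have : G.dist x y ≠ j := fun h2 => h (Fin.ext (h1.symm.trans h2))
      simp [this]
    · simp [h1]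

lemma sum_dualIdempotent (x : X) (h : ∀ y, G.dist x y < D + 1) :
    ∑ i : Fin (D + 1), dualIdempotent G x i = 1 := by
  simpa using sum_smul_dualIdempotent (fun _ => 1) x h

lemma distMatrix_mul_apply {p : ℕ → ℕ → ℕ → ℕ}
    (hp : ∀ i j y z, (Finset.univ.filter fun w => G.dist y w = i ∧ G.dist z w = j).card =
      p (G.dist y z) i j) (i j : ℕ) (y z : X) :
    (distMatrix G i * distMatrix G j) y z = p (G.dist y z) i j := by
  rw [Matrix.mul_apply, ← hp]
  simp only [distMatrix, Matrix.of_apply, ← ite_and, mul_ite, mul_one, mul_zero, Finset.card_filter,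
    Nat.cast_sum, Nat.cast_ite, Nat.cast_one, Nat.cast_zero]
  refine Finset.sum_congr rfl fun w _ => ?_
  rw [SimpleGraph.dist_comm (u := w)]
  exact if_congr and_comm rfl rfl

lemma distMatrix_mul (hlt : ∀ y z, G.dist y z < D + 1) {p : ℕ → ℕ → ℕ → ℕ}
    (hp : ∀ i j y z, (Finset.univ.filter fun w => G.dist y w = i ∧ G.dist z w = j).card =
      p (G.dist y z) i j) (i j : ℕ) :
    distMatrix G i * distMatrix G j = ∑ h : Fin (D + 1), (p h i j : ℂ) • distMatrix G h := by
  ext y z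
  rw [distMatrix_mul_apply hp,
    sum_smul_distMatrix_apply (fun h : Fin (D + 1) => (p h i j : ℂ)) _ _ (hlt y z)]

lemma intersectionNumber_eq_zero (hG : IsDistanceRegular G) (hdiam : G.diam = D)
    {p : ℕ → ℕ → ℕ → ℕ}
    (hp : ∀ i j y z, (Finset.univ.filter fun w => G.dist y w = i ∧ G.dist z w = j).card =
      p (G.dist y z) i j) {h i j : ℕ} (hh : h ≤ D) (hlt : h < i - j ∨ h < j - i ∨ i + j < h) :
    p h i j = 0 := by
  obtain ⟨y, z, rfl⟩ := exists_dist_eq hG hdiam hh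
  rw [← hp, Finset.card_eq_zero, Finset.filter_eq_empty_iff]
  rintro w - ⟨h1, h2⟩
  have t1 := hG.connected.dist_triangle (u := y) (v := z) (w := w)
  have t2 := hG.connected.dist_triangle (u := z) (v := y) (w := w)
  have t3 := hG.connected.dist_triangle (u := y) (v := w) (w := z)
  rw [SimpleGraph.dist_comm (u := z) (v := y)] at t2
  rw [SimpleGraph.dist_comm (u := w) (v := z)] at t3
  omega

lemma intersectionNumber_succ_ne_zero (hG : IsDistanceRegular G) (hdiam : G.diam = D)
    {p : ℕ → ℕ → ℕ → ℕ}
    (hp : ∀ i j y z, (Finset.univ.filter fun w => G.dist y w = i ∧ G.dist z w = j).card =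
      p (G.dist y z) i j) {j : ℕ} (hj : j + 1 ≤ D) :
    p (j + 1) 1 j ≠ 0 := by
  obtain ⟨y, z, h⟩ := exists_dist_eq hG hdiam hj
  obtain ⟨w, h1, h2⟩ := exists_adj_dist_eq hG.connected h
  rw [← h, ← hp, Finset.card_ne_zero]
  exact ⟨w, by simp [h1, SimpleGraph.dist_comm (u := z), h2]⟩

variable {E : Fin (D + 1) → Matrix X X ℂ} {P : Matrix (Fin (D + 1)) (Fin (D + 1)) ℂ}

lemma eigenmatrix_mul (hlt : ∀ y z, G.dist y z < D + 1) {p : ℕ → ℕ → ℕ → ℕ}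
    (hp : ∀ i j y z, (Finset.univ.filter fun w => G.dist y w = i ∧ G.dist z w = j).card =
      p (G.dist y z) i j) (hE : IsPrimitiveIdempotentOrdering G D E)
    (hP : IsFirstEigenmatrix G D E P) (r i j : Fin (D + 1)) :
    P r i * P r j = ∑ h : Fin (D + 1), (p h i j : ℂ) * P r h := by
  have hA : ∀ j : Fin (D + 1), E r * distMatrix G j = P r j • E r := fun j => by
    rw [hP j, idem_mul_sum hE.mul_eq (fun i => P i j)]
  have e : E r * (distMatrix G i * distMatrix G j) =
      E r * ∑ h : Fin (D + 1), (p h i j : ℂ) • distMatrix G h := by rw [distMatrix_mul hlt hp]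
  rw [← mul_assoc, hA, smul_mul_assoc, hA, smul_smul, Finset.mul_sum] at e
  simp only [mul_smul_comm, hA, smul_smul] at e
  rw [← Finset.sum_smul] at e
  exact smul_left_injective ℂ (hE.linearIndependent.ne_zero r) e

lemma eigenvalue_injective (hG : IsDistanceRegular G) (hdiam : G.diam = D) (hD : 1 ≤ D)
    (hE : IsPrimitiveIdempotentOrdering G D E) (hP : IsFirstEigenmatrix G D E P)
    {Q : Matrix (Fin (D + 1)) (Fin (D + 1)) ℂ} (hQ : IsSecondEigenmatrix G D E Q) :
    Function.Injective fun i => P i 1 := by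
  have hlt := dist_lt_succ_diam hG hdiam
  obtain ⟨p, hp⟩ := exists_intersectionNumbers hG
  have h1 : ((1 : Fin (D + 1)) : ℕ) = 1 := by
    rw [Fin.val_one', Nat.mod_eq_of_lt]; omega
  have hA : ∀ r j : Fin (D + 1), E r * distMatrix G j = P r j • E r := fun r j => by
    rw [hP j, idem_mul_sum hE.mul_eq (fun i => P i j)]
  have hP0 : ∀ r, P r 0 = 1 := fun r => by
    have h0 : distMatrix G ((0 : Fin (D + 1)) : ℕ) = 1 := by
      ext y z
      simp [distMatrix, Matrix.one_apply, hG.connected.dist_eq_zero_iff]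
    have e := hA r 0
    rw [h0, mul_one] at e
    exact (smul_left_injective ℂ (hE.linearIndependent.ne_zero r)
      (by simpa using e : (1 : ℂ) • E r = P r 0 • E r)).symm
  intro i r hir
  have key : ∀ j : ℕ, ∀ hj : j < D + 1, P i ⟨j, hj⟩ = P r ⟨j, hj⟩ := by
    intro j
    induction j using Nat.strong_induction_on with
    | _ j ih =>
      intro hj
      obtain _ | j := j
      · exact (hP0 i).trans (hP0 r).symm
      · have e1 := eigenmatrix_mul hlt hp hE hP i 1 ⟨j, by omega⟩
        have e2 := eigenmatrix_mul hlt hp hE hP r 1 ⟨j, by omega⟩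
        have e3 : ∑ h : Fin (D + 1), (p h 1 j : ℂ) * (P i h - P r h) = 0 := by
          rw [h1] at e1 e2
          simp only [mul_sub, Finset.sum_sub_distrib]
          rw [← e1, ← e2, ih j (by omega), show P i 1 = P r 1 from hir, sub_self]
        rw [Finset.sum_eq_single ⟨j + 1, hj⟩] at e3
        · have := intersectionNumber_succ_ne_zero hG hdiam hp (j := j) (by omega)
          exact sub_eq_zero.1 ((mul_eq_zero.1 e3).resolve_left (by exact_mod_cast this))
        · intro h _ hne
          by_cases hle : (h : ℕ) < j + 1
          · rw [ih h hle h.2, sub_self, mul_zero]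
          · have : (h : ℕ) ≠ j + 1 := fun h' => hne (Fin.ext h')
            rw [intersectionNumber_eq_zero hG hdiam hp (by omega) (by omega), Nat.cast_zero,
              zero_mul]
        · simp
  have hc : ∀ s, E s * E i = ((Fintype.card X : ℂ)⁻¹ * ∑ h, Q h i * P s h) • E s := fun s => by
    conv_lhs => rw [hQ i]
    rw [mul_smul_comm, Finset.mul_sum]
    simp only [mul_smul_comm, hA, smul_smul]
    rw [← Finset.sum_smul, smul_smul]
  have hrow : ∀ h, P i h = P r h := fun h => key h h.2
  by_contra hne
  have hci := hc i
  have hcr := hc r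
  rw [hE.mul_eq, if_pos rfl] at hci
  rw [hE.mul_eq, if_neg (fun h => hne h.symm)] at hcr
  simp only [hrow] at hci
  rw [(smul_eq_zero.1 hcr.symm).resolve_right (hE.linearIndependent.ne_zero r), zero_smul] at hci
  exact hE.linearIndependent.ne_zero i hci

lemma primitiveIdempotent_apply {Q : Matrix (Fin (D + 1)) (Fin (D + 1)) ℂ}
    (hQ : IsSecondEigenmatrix G D E Q) (j : Fin (D + 1)) (y z : X) (h : G.dist y z < D + 1) :
    E j y z = (Fintype.card X : ℂ)⁻¹ * Q ⟨G.dist y z, h⟩ j := by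
  rw [hQ j, Matrix.smul_apply, sum_smul_distMatrix_apply (fun i => Q i j) y z h, smul_eq_mul]

/-- With respect to a formally self-dual ordering, the dual adjacency matrix acts tridiagonally. -/
lemma idem_mul_dualAdjacency_mul_eq_zero (hG : IsDistanceRegular G) (hdiam : G.diam = D)
    (hD : 1 ≤ D) (hE : IsPrimitiveIdempotentOrdering G D E) (hP : IsFirstEigenmatrix G D E P)
    (hQ : IsSecondEigenmatrix G D E P) (x : X) {i j : Fin (D + 1)}
    (hij : (i : ℕ) + 1 < j ∨ (j : ℕ) + 1 < i) :
    E i * dualAdjacency E x * E j = 0 := by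
  have hlt := dist_lt_succ_diam hG hdiam
  obtain ⟨p, hp⟩ := exists_intersectionNumbers hG
  have h1 : ((1 : Fin (D + 1)) : ℕ) = 1 := by
    rw [Fin.val_one', Nat.mod_eq_of_lt]; omega
  have hsym : ∀ i y z, E i y z = E i z y := fun i y z => congrFun (congrFun (hE.symm i) z) y
  have hreal : ∀ i y z, star (E i y z) = E i y z := fun i y z =>
    congrFun (congrFun (hE.real i) y) z
  have hherm : ∀ i, (E i).conjTranspose = E i := fun i => by
    ext y z; rw [Matrix.conjTranspose_apply, hreal, hsym]
  have hAherm : (dualAdjacency E x).conjTranspose = dualAdjacency E x := by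
    rw [dualAdjacency, Matrix.diagonal_conjTranspose]
    congr 1; ext y
    simp only [Pi.star_apply, star_mul', hreal, star_natCast]
  have hhad : ∀ y z, E i y z * E j y z =
      (Fintype.card X : ℂ)⁻¹ * ∑ h : Fin (D + 1), (p h i j : ℂ) * E h y z := by
    intro y z
    simp only [primitiveIdempotent_apply hQ _ y z (hlt y z)]
    have e := eigenmatrix_mul hlt hp hE hP ⟨G.dist y z, hlt y z⟩ i j
    rw [mul_mul_mul_comm, e, mul_assoc, Finset.mul_sum]
    congr 1
    exact Finset.sum_congr rfl fun h _ => by ring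
  have htrace : ∑ w, ∑ w', E 1 x w * (E i w w' * E j w w') * E 1 w' x = 0 := by
    have e : ∑ w, ∑ w', E 1 x w * (E i w w' * E j w w') * E 1 w' x =
        (Fintype.card X : ℂ)⁻¹ * ∑ h : Fin (D + 1), (p h i j : ℂ) * (E 1 * E h * E 1) x x := by
      simp only [hhad, Matrix.mul_apply, Finset.mul_sum, Finset.sum_mul]
      rw [Finset.sum_comm]
      refine (Finset.sum_congr rfl fun w' _ => Finset.sum_comm).trans ?_
      rw [Finset.sum_comm]
      refine Finset.sum_congr rfl fun h _ => Finset.sum_congr rfl fun w' _ =>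
        Finset.sum_congr rfl fun w _ => by ring
    rw [e, Finset.sum_eq_single 1, h1, intersectionNumber_eq_zero hG hdiam hp hD (by omega)]
    · simp
    · intro h _ hne
      simp [hE.mul_eq, hne.symm]
    · simp
  have hfin : ((E i * dualAdjacency E x * E j).conjTranspose *
      (E i * dualAdjacency E x * E j)).trace = 0 := by
    have e : ((E i * dualAdjacency E x * E j).conjTranspose *
        (E i * dualAdjacency E x * E j)).trace =
        (dualAdjacency E x * E i * dualAdjacency E x * E j).trace := by
      rw [Matrix.conjTranspose_mul, Matrix.conjTranspose_mul, hherm, hherm, hAherm]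
      have e1 : E j * (dualAdjacency E x * E i) * (E i * dualAdjacency E x * E j) =
          E j * (dualAdjacency E x * (E i * E i) * dualAdjacency E x * E j) := by
        simp only [mul_assoc]
      rw [e1, Matrix.trace_mul_comm, hE.mul_eq, if_pos rfl, mul_assoc _ (E j), hE.mul_eq,
        if_pos rfl]
    rw [e, Matrix.trace]
    have e2 : ∀ w, (dualAdjacency E x * E i * dualAdjacency E x * E j).diag w =
        (Fintype.card X : ℂ) ^ 2 * ∑ w', E 1 x w * (E i w w' * E j w w') * E 1 w' x := by
      intro w
      rw [Matrix.diag_apply, Matrix.mul_apply, Finset.mul_sum]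
      refine Finset.sum_congr rfl fun w' _ => ?_
      rw [dualAdjacency, Matrix.mul_diagonal, Matrix.diagonal_mul, hsym j w' w, hsym 1 w' x]
      ring
    rw [Finset.sum_congr rfl fun w _ => e2 w, ← Finset.mul_sum, htrace, mul_zero]
  open scoped ComplexOrder in
  exact Matrix.trace_conjTranspose_mul_self_eq_zero_iff.1 hfin

lemma dualIdempotent_mul_distMatrix_mul_eq_zero (hG : G.Connected) (x : X) {i j : ℕ}
    (hij : i + 1 < j ∨ j + 1 < i) :
    dualIdempotent G x i * distMatrix G 1 * dualIdempotent G x j = 0 := by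
  ext y z
  rw [dualIdempotent, dualIdempotent, Matrix.mul_diagonal, Matrix.diagonal_mul, distMatrix,
    Matrix.of_apply, Matrix.zero_apply]
  by_cases h1 : G.dist x y = i
  · by_cases h2 : G.dist x z = j
    · have : G.dist y z ≠ 1 := fun h3 => by
        have t1 := hG.dist_triangle (u := x) (v := y) (w := z)
        have t2 := hG.dist_triangle (u := x) (v := z) (w := y)
        rw [SimpleGraph.dist_comm (u := z)] at t2
        omega
      simp [this]
    · simp [h2]
  · simp [h1]

end DistanceRegular

section SpinModel

variable {X : Type*} [Fintype X] [DecidableEq X] {G : SimpleGraph X} {D : ℕ}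
  {E : Fin (D + 1) → Matrix X X ℂ} {P : Matrix (Fin (D + 1)) (Fin (D + 1)) ℂ} {q a α ε : ℂ}

/-- The braid relation for `∑ i, τ i E i` and the diagonal matrix that represents
`∑ i, τ i E* i`. -/
lemma tau_braid (hG : IsDistanceRegular G) (hdiam : G.diam = D) (hD : 1 ≤ D)
    (hE : IsPrimitiveIdempotentOrdering G D E) (hP : IsFirstEigenmatrix G D E P)
    (hQ : IsSecondEigenmatrix G D E P) (hq0 : q ≠ 0) (hq1 : q ^ 2 ≠ 1) (hq2 : q ^ 2 ≠ -1)
    (ha : a ≠ 0) (hα : α ≠ 0)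
    (hθ : ∀ i : Fin (D + 1), P i 1 = α * racahEigenvalue D a q i + ε) (x : X)
    (hZ : ZEquality G E (fun i => P i 1) q α ε x) {T T' : Matrix X X ℂ}
    (hT : T = ∑ i : Fin (D + 1), tau D a q i • E i)
    (hT' : T' = Matrix.diagonal fun y => tau D a q (G.dist x y)) :
    T * T' * T * dualIdempotent G x 0 = E 0 * (T * T' * T) ∧ T * T' * T = T' * T * T' := by
  have hlt := dist_lt_succ_diam hG hdiam
  have h1 : ((1 : Fin (D + 1)) : ℕ) = 1 := by
    rw [Fin.val_one', Nat.mod_eq_of_lt]; omega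
  have hn : (Fintype.card X : ℂ) ≠ 0 := by
    have := hG.connected.nonempty
    exact_mod_cast Fintype.card_ne_zero
  have hθ' : ∀ i : Fin (D + 1), (P i 1 - ε) / α = racahEigenvalue D a q i := fun i => by
    rw [hθ]; field_simp; ring
  have hinj : Function.Injective fun i : Fin (D + 1) => racahEigenvalue D a q i := by
    intro i j hij
    apply eigenvalue_injective hG hdiam hD hE hP hQ
    simp only [hθ]
    rw [show racahEigenvalue D a q i = racahEigenvalue D a q j from hij]
  have hnorm : ∀ F : Fin (D + 1) → Matrix X X ℂ, ∑ i, F i = 1 →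
      α⁻¹ • ((∑ i, P i 1 • F i) - ε • (1 : Matrix X X ℂ)) =
        ∑ i : Fin (D + 1), racahEigenvalue D a q i • F i := by
    intro F hF
    rw [← hF, Finset.smul_sum, ← Finset.sum_sub_distrib, Finset.smul_sum]
    refine Finset.sum_congr rfl fun i _ => ?_
    rw [← sub_smul, smul_smul, ← hθ', div_eq_inv_mul]
  have hA := hnorm E hE.sum_eq
  rw [← hP 1, h1] at hA
  have hA' := hnorm (fun i => dualIdempotent G x i) (sum_dualIdempotent x (hlt x))
  have hdual : dualAdjacency E x = ∑ i : Fin (D + 1), P i 1 • dualIdempotent G x i := by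
    rw [sum_smul_dualIdempotent (fun i => P i 1) x (hlt x), dualAdjacency]
    congr 1; ext y
    rw [primitiveIdempotent_apply hQ 1 x y (hlt x y), mul_inv_cancel_left₀ hn]
  rw [← hdual] at hA'
  unfold ZEquality at hZ
  simp only [hθ'] at hZ
  have hoff : ∀ (F : Fin (D + 1) → Matrix X X ℂ) (B : Matrix X X ℂ),
      (∀ i j, F i * F j = if i = j then F i else 0) → ∀ i j, i ≠ j → F i * B * F j = 0 →
      F i * (α⁻¹ • (B - ε • (1 : Matrix X X ℂ))) * F j = 0 := by
    intro F B hF i j hij h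
    simp [mul_sub, sub_mul, h, hF, hij]
  have key := racah_braid hE.mul_eq hE.sum_eq (dualIdempotent_mul x)
    (sum_dualIdempotent x (hlt x)) ha hq0 hq1 hq2 hinj hA hA'
    (fun i j hij => hoff E _ hE.mul_eq i j (by rintro rfl; omega)
      (idem_mul_dualAdjacency_mul_eq_zero hG hdiam hD hE hP hQ x hij))
    (fun i j hij => hoff _ _ (dualIdempotent_mul x) i j (by rintro rfl; omega)
      (dualIdempotent_mul_distMatrix_mul_eq_zero hG.connected x hij))
    hZ hT (W' := T') (by
      rw [hT', sum_smul_dualIdempotent (fun i : Fin (D + 1) => tau D a q i) x (hlt x)])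
  exact ⟨key.1 0, key.2⟩

lemma sum_valency (hlt : ∀ y z, G.dist y z < D + 1) {k : Fin (D + 1) → ℕ}
    (hk : ∀ (i : Fin (D + 1)) (y : X),
      (Finset.univ.filter fun z => G.dist y z = (i : ℕ)).card = k i) (c : ℕ → ℂ) (x : X) :
    ∑ y, c (G.dist x y) = ∑ i : Fin (D + 1), c i * (k i : ℂ) := by
  have e : ∀ y, c (G.dist x y) = ∑ i : Fin (D + 1), if G.dist x y = (i : ℕ) then c i else 0 := by
    intro y
    rw [Finset.sum_eq_single ⟨G.dist x y, hlt x y⟩]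
    · simp
    · intro i _ hi
      exact if_neg fun h => hi (Fin.ext h.symm)
    · simp
  rw [Finset.sum_congr rfl fun y _ => e y, Finset.sum_comm]
  refine Finset.sum_congr rfl fun i _ => ?_
  rw [← Finset.sum_filter, Finset.sum_const, hk, nsmul_eq_mul, mul_comm]

/-- The entries of `∑ i, τ i E i`. -/
lemma tau_entry (hG : IsDistanceRegular G) (hdiam : G.diam = D)
    (hE : IsPrimitiveIdempotentOrdering G D E) (hq0 : q ≠ 0) (ha : a ≠ 0)
    {k : Fin (D + 1) → ℕ}
    (hk : ∀ (i : Fin (D + 1)) (y : X),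
      (Finset.univ.filter fun z => G.dist y z = (i : ℕ)).card = k i) {T : Matrix X X ℂ}
    (hT : T = ∑ i : Fin (D + 1), tau D a q i • E i)
    (hb : ∀ x, ∀ T' : Matrix X X ℂ, T' = Matrix.diagonal (fun y => tau D a q (G.dist x y)) →
      T * T' * T * dualIdempotent G x 0 = E 0 * (T * T' * T) ∧ T * T' * T = T' * T * T') :
    ∑ i : Fin (D + 1), (tau D a q i)⁻¹ * (k i : ℂ) ≠ 0 ∧
    ∀ y x, T y x = (∑ i : Fin (D + 1), (tau D a q i)⁻¹ * (k i : ℂ))⁻¹ *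
      (tau D a q (G.dist x y))⁻¹ := by
  have hlt := dist_lt_succ_diam hG hdiam
  have hn : (Fintype.card X : ℂ) ≠ 0 := by
    have := hG.connected.nonempty
    exact_mod_cast Fintype.card_ne_zero
  have ht0 : tau D a q 0 = 1 := by simp [tau]
  have hcol : ∀ x, ∑ y, T y x = 1 := by
    intro x
    have e : E 0 * T = E 0 := by
      rw [hT, idem_mul_sum hE.mul_eq (fun i : Fin (D + 1) => tau D a q i)]
      simp [ht0]
    have e1 := congrFun (congrFun e x) x
    rw [Matrix.mul_apply, hE.zero_eq] at e1
    simp only [Matrix.smul_apply, Matrix.of_apply, smul_eq_mul, mul_one] at e1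
    rw [← Finset.mul_sum] at e1
    exact mul_left_cancel₀ (inv_ne_zero hn) (by rw [e1, mul_one])
  have hc : ∀ x, ∃ c, ∀ y, T y x = c * (tau D a q (G.dist x y))⁻¹ := by
    intro x
    obtain ⟨b1, b2⟩ := hb x _ rfl
    rw [b2] at b1
    refine ⟨(Fintype.card X : ℂ)⁻¹ * ∑ z, tau D a q (G.dist x z) * T z x, fun y => ?_⟩
    have e1 := congrFun (congrFun b1 y) x
    rw [dualIdempotent, Matrix.mul_diagonal, Matrix.mul_diagonal, Matrix.diagonal_mul,
      Matrix.mul_apply, hE.zero_eq] at e1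
    simp only [Matrix.mul_diagonal, Matrix.diagonal_mul, SimpleGraph.dist_self, ht0, if_true,
      mul_one, Matrix.smul_apply, Matrix.of_apply, smul_eq_mul] at e1
    rw [← Finset.mul_sum] at e1
    rw [← e1, mul_comm (tau D a q _), mul_inv_cancel_right₀ (tau_ne_zero ha hq0 D _)]
  have hS : ∀ x c, (∀ y, T y x = c * (tau D a q (G.dist x y))⁻¹) →
      c * ∑ i : Fin (D + 1), (tau D a q i)⁻¹ * (k i : ℂ) = 1 := by
    intro x c h
    rw [← hcol x, ← sum_valency hlt hk (fun i => (tau D a q i)⁻¹) x, Finset.mul_sum]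
    exact Finset.sum_congr rfl fun y _ => (h y).symm
  refine ⟨?_, fun y x => ?_⟩
  · obtain ⟨x⟩ := hG.connected.nonempty
    obtain ⟨c, h⟩ := hc x
    exact right_ne_zero_of_mul_eq_one (hS x c h)
  · obtain ⟨c, h⟩ := hc x
    rw [h y, eq_inv_of_mul_eq_one_left (hS x c h)]

/-- The inverse of `∑ i, τ i E i` for a formally self-dual ordering. -/
lemma tau_mul_sum_distMatrix (hG : IsDistanceRegular G) (hdiam : G.diam = D)
    (hE : IsPrimitiveIdempotentOrdering G D E) (hP : IsFirstEigenmatrix G D E P)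
    (hQ : IsSecondEigenmatrix G D E P) (hq0 : q ≠ 0) (ha : a ≠ 0) {S : ℂ} {T : Matrix X X ℂ}
    (hT : T = ∑ i : Fin (D + 1), tau D a q i • E i)
    (hentry : ∀ y x, T y x = S⁻¹ * (tau D a q (G.dist x y))⁻¹) :
    T * ∑ i : Fin (D + 1), tau D a q i • distMatrix G i =
      ((Fintype.card X : ℂ) * S⁻¹) • (1 : Matrix X X ℂ) := by
  have hlt := dist_lt_succ_diam hG hdiam
  have hn : (Fintype.card X : ℂ) ≠ 0 := by
    have := hG.connected.nonempty
    exact_mod_cast Fintype.card_ne_zero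
  have hPsum : ∀ i : Fin (D + 1), ∑ j : Fin (D + 1), tau D a q j * P i j =
      (Fintype.card X : ℂ) * S⁻¹ * (tau D a q i)⁻¹ := by
    intro i
    obtain ⟨x, y, h⟩ := exists_dist_eq hG hdiam (Nat.lt_succ_iff.1 i.2)
    have e := hentry y x
    rw [hT, Matrix.sum_apply] at e
    have hi : ∀ hh, (⟨G.dist y x, hh⟩ : Fin (D + 1)) = i := fun hh =>
      Fin.ext (SimpleGraph.dist_comm.trans h)
    simp only [Matrix.smul_apply, primitiveIdempotent_apply hQ _ y x (hlt y x), smul_eq_mul,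
      hi, h] at e
    rw [mul_assoc, ← e, Finset.mul_sum]
    refine Finset.sum_congr rfl fun j _ => ?_
    rw [mul_left_comm, mul_inv_cancel_left₀ hn]
  have hU : ∑ j : Fin (D + 1), tau D a q j • distMatrix G j =
      ∑ i : Fin (D + 1), ((Fintype.card X : ℂ) * S⁻¹ * (tau D a q i)⁻¹) • E i := by
    rw [Finset.sum_congr rfl fun j _ => by rw [hP j, Finset.smul_sum], Finset.sum_comm]
    refine Finset.sum_congr rfl fun i _ => ?_
    rw [← hPsum, Finset.sum_smul]
    simp only [smul_smul]
  rw [hU, hT, sum_mul_sum_idem hE.mul_eq (fun i : Fin (D + 1) => tau D a q i), ← hE.sum_eq,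
    Finset.smul_sum]
  refine Finset.sum_congr rfl fun i _ => ?_
  rw [mul_left_comm, mul_inv_cancel₀ (tau_ne_zero ha hq0 D i), mul_one]

lemma isSpinModel_matrixW_iff (hlt : ∀ y z, G.dist y z < D + 1)
    [Nonempty X] (hq0 : q ≠ 0) (ha : a ≠ 0) {S f : ℂ}
    (hf : f ≠ 0) (hS : S ≠ 0) {T : Matrix X X ℂ}
    (hT : T = ∑ i : Fin (D + 1), tau D a q i • E i)
    (hentry : ∀ y x, T y x = S⁻¹ * (tau D a q (G.dist x y))⁻¹)
    (hinv : T * ∑ i : Fin (D + 1), tau D a q i • distMatrix G i =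
      ((Fintype.card X : ℂ) * S⁻¹) • (1 : Matrix X X ℂ))
    (hb : ∀ x, ∀ T' : Matrix X X ℂ, T' = Matrix.diagonal (fun y => tau D a q (G.dist x y)) →
      T * T' * T = T' * T * T') :
    IsSpinModel (matrixW E a q f) ↔
      f ^ 2 = ((Real.sqrt (Fintype.card X : ℝ) : ℝ) : ℂ) * S := by
  have ht : ∀ i, tau D a q i ≠ 0 := tau_ne_zero ha hq0 D
  have hW : ∀ y x, matrixW E a q f y x = f * (S⁻¹ * (tau D a q (G.dist x y))⁻¹) := fun y x => by
    rw [matrixW, ← hT, Matrix.smul_apply, smul_eq_mul, hentry]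
  have hW' : ∀ y x, matrixW E a q f y x = f * T y x := fun y x => by rw [hW, hentry]
  have hTs : ∀ y x, T y x = T x y := fun y x => by
    rw [hentry, hentry, SimpleGraph.dist_comm]
  have hstar : ∀ x b c, ∑ e, matrixW E a q f e b * matrixW E a q f e c / matrixW E a q f e x =
      f * S * (tau D a q (G.dist x b) * T b c * tau D a q (G.dist x c)) := by
    intro x b c
    have e := congrFun (congrFun (hb x _ rfl) b) c
    rw [Matrix.mul_apply, Matrix.mul_diagonal, Matrix.diagonal_mul] at e
    rw [← e, Finset.mul_sum]
    refine Finset.sum_congr rfl fun z _ => ?_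
    rw [Matrix.mul_diagonal, hW' z b, hW' z c, hW z x, hTs b z]
    have := ht (G.dist x z)
    field_simp
  have hright : ∀ x b c, matrixW E a q f b c / (matrixW E a q f x b * matrixW E a q f c x) =
      S ^ 2 / f * (tau D a q (G.dist x b) * T b c * tau D a q (G.dist x c)) := by
    intro x b c
    rw [hW' b c, hW x b, hW c x, SimpleGraph.dist_comm (u := b)]
    have := ht (G.dist x b)
    have := ht (G.dist x c)
    field_simp
  constructor
  · intro h
    obtain ⟨x⟩ := ‹Nonempty X›
    have e := h.starTriangle x x x
    rw [hstar, hright, hentry] at e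
    have h0 := ht (G.dist x x)
    field_simp at e
    linear_combination e
  · intro h
    refine ⟨?_, ⟨fun y x => ?_, ?_⟩, fun x b c => ?_⟩
    · ext y x
      rw [Matrix.transpose_apply, hW, hW, SimpleGraph.dist_comm]
    · rw [hW]
      exact mul_ne_zero hf (mul_ne_zero (inv_ne_zero hS) (inv_ne_zero (ht _)))
    · rw [Submodule.mem_span_singleton]
      refine ⟨Fintype.card X, ?_⟩
      have e : matrixW E a q f * invTranspose (matrixW E a q f) =
          S • (T * ∑ i : Fin (D + 1), tau D a q i • distMatrix G i) := by
        ext y x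
        rw [Matrix.smul_apply, Matrix.mul_apply, Matrix.mul_apply, Finset.smul_sum]
        refine Finset.sum_congr rfl fun z _ => ?_
        rw [sum_smul_distMatrix_apply (fun i : Fin (D + 1) => tau D a q i) z x (hlt z x),
          invTranspose, Matrix.of_apply, hW' y z, hW x z, smul_eq_mul]
        have := ht (G.dist z x)
        field_simp
      rw [e, hinv, smul_smul, mul_left_comm, mul_inv_cancel₀ hS, mul_one]
    · have e : f * S = ((Real.sqrt (Fintype.card X : ℝ) : ℝ) : ℂ) * (S ^ 2 / f) := by
        field_simp
        linear_combination h
      rw [hstar, hright, e, mul_assoc]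

end SpinModel

end SpinDRG

theorem theorem14p2 {X : Type*} [Fintype X] [DecidableEq X] (G : SimpleGraph X)
    (hG : SpinDRG.IsDistanceRegular G)
    (D : ℕ) (hdiam : G.diam = D) (hD : 3 ≤ D)
    -- the valencies
    (k : Fin (D + 1) → ℕ)
    (hk : ∀ (i : Fin (D + 1)) (y : X),
      (Finset.univ.filter fun z => G.dist y z = (i : ℕ)).card = k i)
    -- a formally self-dual ordering of the primitive idempotents
    (E : Fin (D + 1) → Matrix X X ℂ)
    (hE : SpinDRG.IsPrimitiveIdempotentOrdering G D E)
    (P Q : Matrix (Fin (D + 1)) (Fin (D + 1)) ℂ)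
    (hP : SpinDRG.IsFirstEigenmatrix G D E P)
    (hQ : SpinDRG.IsSecondEigenmatrix G D E Q)
    (hself : P = Q)
    -- the ordering has `q`-Racah type: `θ i = P i 1` and `θ* i = Q i 1`
    (q a α ε : ℂ) (hq0 : q ≠ 0) (hq1 : q ^ 2 ≠ 1) (hq2 : q ^ 2 ≠ -1)
    (ha : a ≠ 0) (hα : α ≠ 0)
    (hθ : ∀ i : Fin (D + 1), P i 1 =
      α * (a * q ^ (2 * ((i : ℕ) : ℤ) - (D : ℤ)) + a⁻¹ * q ^ ((D : ℤ) - 2 * ((i : ℕ) : ℤ))) + ε)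
    -- the two expressions for `Z(x)` agree for every base vertex `x`
    (hZ : ∀ x : X, SpinDRG.ZEquality G E (fun i => P i 1) q α ε x)
    (f : ℂ) (hf : f ≠ 0) :
    SpinDRG.IsSpinModel (SpinDRG.matrixW E a q f) ↔
      f ^ 2 = ((Real.sqrt (Fintype.card X : ℝ) : ℝ) : ℂ) *
        ∑ i : Fin (D + 1), (SpinDRG.tau D a q i)⁻¹ * (k i : ℂ) := by
  subst hself
  have hb := fun (x : X) (T' : Matrix X X ℂ) hT' =>
    SpinDRG.tau_braid hG hdiam (by omega) hE hP hQ hq0 hq1 hq2 ha hα hθ x (hZ x) rfl (T' := T') hT'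
  obtain ⟨hS, hentry⟩ := SpinDRG.tau_entry hG hdiam hE hq0 ha hk rfl hb
  have := hG.connected.nonempty
  exact SpinDRG.isSpinModel_matrixW_iff (SpinDRG.dist_lt_succ_diam hG hdiam) hq0 ha hf hS rfl
    hentry (SpinDRG.tau_mul_sum_distMatrix hG hdiam hE hP hQ hq0 ha rfl hentry)
    fun x T' hT' => (hb x T' hT').2
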